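/- Let $\mu$ be a measure on a measurable space, let $p(\cdot;\beta)\ge 0$ be a family of $\mu$-integrable functions whose parameter $\beta$ ranges over a neighbourhood in a Euclidean space of the true value $\beta^*$, and let the data density be $p_d=p(\cdot;\beta^*)$, with $\int p_d\,d\mu=1$. The model is either \emph{normalized}, $\beta=\theta\in\mathbb R^d$ and $\int p(x;\beta)\,d\mu(x)=1$ for all $\beta$, with differentiation of this integral at $\beta^*$ under the integral sign justified by the usual domination condition $|p(x;\beta)-p(x;\beta^*)|\le g(x)\|\beta-\beta^*\|$, $g\in L^1(\mu)$; or \emph{unnormalized}, $\beta=(\theta,c)\in\mathbb R^d\times\mathbb R$ and $p(x;(\theta,c))=q(x;\theta)e^{-c}$. Assume that $\beta\mapsto p(x;\beta)$ is differentiable at $\beta^*$ for $\mu$-almost every $x$, write $\psi(x)=\nabla_\beta\log p(x;\beta^*)$ for the (generalized) score, and assume that $\mathbb E_{p_d}\|\psi\|^2<\infty$ and that $I=\mathbb E_{p_d}[\psi\psi^\top]$ is invertible. For a total budget $T>0$ of observations, a noise-data ratio $\nu>0$ and a noise density $p_n$, put $w=\nu p_n/(p_d+\nu p_n)$, $m_w=\mathbb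 E_{p_d}[w\psi]$, $I_w=\mathbb E_{p_d}[w\psi\psi^\top]$; the (asymptotic) mean-squared error of noise-contrastive estimation is $$\mathrm{MSE}(T,\nu,p_n)=\frac{\nu+1}{T}\,\mathrm{tr}\Big(I_w^{-1}-\frac{\nu+1}{\nu}\,I_w^{-1}m_wm_w^\top I_w^{-1}\Big).$$ Let $w_1(x)=\|I^{-1}\psi(x)\|$ and $p_n^{\mathrm{opt}}=p_dw_1/\int p_dw_1\,d\mu$. Then, for every fixed $T>0$, for normalized and for unnormalized models, $$\lim_{\nu\to\infty}\big(\mathrm{MSE}(T,\nu,p_d)-\mathrm{MSE}(T,\nu,p_n^{\mathrm{opt}})\big)=\frac1T\,\mathrm{Var}_{x\sim p_d}\big(w_1(x)\big).$$ Furthermore, for normalized models, with the Cramér–Rao value $\mathrm{MSE}_{\mathrm{CR}}(T,\nu)=\frac1{T_d}\mathrm{tr}(I^{-1})$ for the $T_d=T/(\nu+1)$ data observations, $$\lim_{\nu\to\infty}\big(\mathrm{MSE}(T,\nu,p_n^{\mathrm{opt}})-\mathrm{MSE}_{\mathrm{CR}}(T,\nu)\big)=\frac1T\big(\mathbb E_{x\sim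 p_d}\|I^{-1}\psi(x)\|\big)^2.$$ -/

import Mathlib

open MeasureTheory Filter Topology ProbabilityTheory
open scoped Matrix

namespace NCE

noncomputable section

/-- Parameter space: real vectors indexed by `ι`, with the Euclidean norm. -/
abbrev Param (ι : Type*) := EuclideanSpace ℝ ι

/-- The probability distribution with density `f` with respect to the base measure `μ`. -/
def law {X : Type*} [MeasurableSpace X] (μ : Measure X) (f : X → ℝ) : Measure X :=
  μ.withDensity fun x => ENNReal.ofReal (f x)

/-- The (generalized) Fisher score `∇_β log p(x; β)`. It equals the parameter gradient of the
classifier `F(x; β) = log (p(x; β) / (ν pₙ(x)))`. -/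
def score {X ι : Type*} [Fintype ι] (p : Param ι → X → ℝ) (β : Param ι) (x : X) : Param ι :=
  gradient (fun b => Real.log (p b x)) β

/-- The score mean `m_w = E_{x ∼ p_d} [w(x) ψ(x)]`, with `p_d = p β` and `ψ` the score at `β`. -/
def scoreMean {X ι : Type*} [MeasurableSpace X] [Fintype ι] (μ : Measure X)
    (p : Param ι → X → ℝ) (β : Param ι) (w : X → ℝ) : ι → ℝ :=
  fun i => ∫ x, w x * score p β x i ∂(law μ (p β))

/-- The matrix `I_w = E_{x ∼ p_d} [w(x) ψ(x) ψ(x)ᵀ]`, with `p_d = p β`. -/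
def scoreCov {X ι : Type*} [MeasurableSpace X] [Fintype ι] (μ : Measure X)
    (p : Param ι → X → ℝ) (β : Param ι) (w : X → ℝ) : Matrix ι ι ℝ :=
  Matrix.of fun i j => ∫ x, w x * score p β x i * score p β x j ∂(law μ (p β))

/-- The unweighted matrix `I = E_{x ∼ p_d} [ψ(x) ψ(x)ᵀ]`; for a normalized model this is the
Fisher information matrix. -/
def fisherInfo {X ι : Type*} [MeasurableSpace X] [Fintype ι] (μ : Measure X)
    (p : Param ι → X → ℝ) (β : Param ι) : Matrix ι ι ℝ :=
  scoreCov μ p β fun _ => 1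

/-- `P(Y = 0 | x) = ν pₙ(x) / (p_d(x) + ν pₙ(x))`: the posterior probability that `x` is noise,
which is the weight of the logistic classification loss. -/
def noisePosterior {X : Type*} (ν : ℝ) (pd pn : X → ℝ) (x : X) : ℝ :=
  ν * pn x / (pd x + ν * pn x)

/-- The (asymptotic) mean-squared error of noise-contrastive estimation at the true parameter
`β`, for a total budget of `T` observations, a noise-data ratio `ν` and noise density `pn`:
`(ν + 1) / T * tr (I_w⁻¹ - (ν + 1) / ν • I_w⁻¹ m_w m_wᵀ I_w⁻¹)`, with `w = P(Y = 0 | x)`. -/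
def mse {X ι : Type*} [MeasurableSpace X] [Fintype ι] [DecidableEq ι] (μ : Measure X)
    (p : Param ι → X → ℝ) (β : Param ι) (T ν : ℝ) (pn : X → ℝ) : ℝ :=
  let w := noisePosterior ν (p β) pn
  let Iw := scoreCov μ p β w
  let mw := scoreMean μ p β w
  (ν + 1) / T *
    Matrix.trace (Iw⁻¹ - ((ν + 1) / ν) • (Iw⁻¹ * Matrix.vecMulVec mw mw * Iw⁻¹))

/-- The Cramér–Rao mean-squared error `tr (I⁻¹) / T_d`, where `T_d = T / (ν + 1)` is the number
of data observations. -/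
def mseCramerRao {X ι : Type*} [MeasurableSpace X] [Fintype ι] [DecidableEq ι] (μ : Measure X)
    (p : Param ι → X → ℝ) (β : Param ι) (T ν : ℝ) : ℝ :=
  1 / (T / (ν + 1)) * Matrix.trace (fisherInfo μ p β)⁻¹

/-- The reweighting function `w₁(x) = ‖I⁻¹ ψ(x)‖`, i.e. the norm of the score in the metric
`I⁻²`. -/
def weightOne {X ι : Type*} [MeasurableSpace X] [Fintype ι] [DecidableEq ι] (μ : Measure X)
    (p : Param ι → X → ℝ) (β : Param ι) (x : X) : ℝ :=
  ‖(WithLp.toLp 2 ((fisherInfo μ p β)⁻¹ *ᵥ (score p β x).ofLp) : Param ι)‖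

/-- The normalized product `f • g = f g / ∫ f g` of two functions. -/
def normalizedProduct {X : Type*} [MeasurableSpace X] (μ : Measure X) (f g : X → ℝ) (x : X) : ℝ :=
  f x * g x / ∫ y, f y * g y ∂μ

/-- The optimal noise density `p_d • w₁`. -/
def optimalNoise {X ι : Type*} [MeasurableSpace X] [Fintype ι] [DecidableEq ι] (μ : Measure X)
    (p : Param ι → X → ℝ) (β : Param ι) : X → ℝ :=
  normalizedProduct μ (p β) (weightOne μ p β)

/-- The standing assumptions for a parametric model `p`, possibly unnormalized, whose parameter
ranges over a neighbourhood `Θ` of the true value `β`: the data density is `p β`, the score at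
`β` exists and has a finite and invertible second moment matrix. -/
structure IsModel {X ι : Type*} [MeasurableSpace X] [Fintype ι] [DecidableEq ι] (μ : Measure X)
    (Θ : Set (Param ι)) (p : Param ι → X → ℝ) (β : Param ι) : Prop where
  mem_nhds : Θ ∈ 𝓝 β
  nonneg : ∀ b ∈ Θ, ∀ x, 0 ≤ p b x
  integrable : ∀ b ∈ Θ, Integrable (p b) μ
  integral_data : ∫ x, p β x ∂μ = 1
  differentiable : ∀ᵐ x ∂μ, DifferentiableAt ℝ (fun b => p b x) β
  finite_info : Integrable (fun x => ‖score p β x‖ ^ 2) (law μ (p β))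
  invertible_info : IsUnit (fisherInfo μ p β).det

/-- A normalized model: every `p b` is a probability density. The last field is the usual
domination condition for differentiating `∫ p b` under the integral sign at `b = β`. -/
structure IsNormalizedModel {X ι : Type*} [MeasurableSpace X] [Fintype ι] [DecidableEq ι]
    (μ : Measure X) (Θ : Set (Param ι)) (p : Param ι → X → ℝ) (β : Param ι) : Prop
    extends IsModel μ Θ p β where
  normalized : ∀ b ∈ Θ, ∫ x, p b x ∂μ = 1
  dominated : ∃ g : X → ℝ, Integrable g μ ∧
    ∀ᵐ x ∂μ, ∀ b ∈ Θ, |p b x - p β x| ≤ g x * ‖b - β‖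

/-- The unnormalized (energy-based) model with a free log-normalization constant: the parameter
is `β = (θ, c)` and `p(x; (θ, c)) = q(x; θ) / exp c`. -/
def unnormalized {X κ : Type*} (q : Param κ → X → ℝ) (β : Param (κ ⊕ Unit)) (x : X) : ℝ :=
  q (WithLp.toLp 2 fun k => β (Sum.inl k)) x / Real.exp (β (Sum.inr ()))

end

end NCE

namespace NCE

/-! Write `z = E[w₁]`. For the optimal noise the density `p_d` cancels from the posterior, leaving
`1 - w = z / (z + ν w₁)`, so `(ν + 1)(I - I_w)` tends to `D = E[(z / w₁) ψψᵀ]`. Inverting to first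
order, `(ν + 1)(I_w⁻¹ - I⁻¹)` tends to `I⁻¹ D I⁻¹`, whose trace is `E[(z / w₁) w₁²] = z²`
(`tendsto_trace_inv_optimalNoise`). For `p_n = p_d` the weight is the constant `ν / (ν + 1)`, so the
error is explicit (`mse_data`). As `tr I⁻¹ = E[w₁²]`, the trace terms differ in the limit by
`(E[w₁²] - z²) / T`, the variance; against Cramér–Rao only `z² / T` remains.

The limits under the integral rest on `|ψ_i| ≤ C w₁` (`exists_abs_score_le`), which also makes the
points with `w₁ = 0` harmless.

The penalty from `m_w` drops out for different reasons. In a normalized model `E[ψ] = 0`, so `m_w =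
O(1/ν)` and its quadratic penalty is negligible. In an unnormalized model the score in `c` is `-1`,
so the penalty is exactly `1` for both noises and cancels (`meanPenalty_unnormalized`). -/

lemma exists_seq_tendsto_zero_add_smul_mem {E : Type*} [NormedAddCommGroup E] [NormedSpace ℝ E]
    {Θ : Set E} {β : E} (hΘ : Θ ∈ 𝓝 β) (v : E) :
    ∃ t : ℕ → ℝ, (∀ n, 0 < t n) ∧ Tendsto t atTop (𝓝[>] 0) ∧ ∀ n, β + t n • v ∈ Θ := by
  have h0 : Tendsto (fun n : ℕ => 1 / ((n : ℝ) + 1)) atTop (𝓝 0) :=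
    tendsto_one_div_add_atTop_nhds_zero_nat
  have hc : Tendsto (fun s : ℝ => β + s • v) (𝓝 0) (𝓝 β) := by
    have : Continuous fun s : ℝ => β + s • v := by fun_prop
    simpa using this.tendsto 0
  obtain ⟨N, hN⟩ := eventually_atTop.1 ((hc.comp h0).eventually hΘ)
  have hpos : ∀ n : ℕ, 0 < 1 / (((n + N : ℕ) : ℝ) + 1) := fun n => by positivity
  refine ⟨fun n => 1 / (((n + N : ℕ) : ℝ) + 1), hpos, ?_, fun n => hN (n + N) (by omega)⟩
  exact tendsto_nhdsWithin_iff.2 ⟨h0.comp (tendsto_add_atTop_nat N), Eventually.of_forall hpos⟩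

lemma tendsto_slope_of_hasGradientAt {ι : Type*} [Fintype ι] [DecidableEq ι]
    {f : Param ι → ℝ} {g β : Param ι} (hf : HasGradientAt f g β) (i : ι) :
    Tendsto (fun t : ℝ => t⁻¹ * (f (β + t • EuclideanSpace.single i 1) - f β))
      (𝓝[>] 0) (𝓝 (g i)) := by
  have h := (hf.hasFDerivAt.hasLineDerivAt (EuclideanSpace.single i 1)).tendsto_slope_zero_right
  simpa [EuclideanSpace.inner_single_right] using h

/-! ### Regularity and moments of the score -/

section Model

variable {X ι : Type*} [MeasurableSpace X] [Fintype ι] [DecidableEq ι] {μ : Measure X}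
  {Θ : Set (Param ι)} {p : Param ι → X → ℝ} {β : Param ι}

namespace IsModel

lemma nonneg_data (h : IsModel μ Θ p β) (x : X) : 0 ≤ p β x :=
  h.nonneg β (mem_of_mem_nhds h.mem_nhds) x

lemma integrable_data (h : IsModel μ Θ p β) : Integrable (p β) μ :=
  h.integrable β (mem_of_mem_nhds h.mem_nhds)

lemma isProbabilityMeasure_law (h : IsModel μ Θ p β) : IsProbabilityMeasure (law μ (p β)) := by
  refine ⟨?_⟩
  rw [law, withDensity_apply _ MeasurableSet.univ, Measure.restrict_univ,
    ← ofReal_integral_eq_lintegral_ofReal h.integrable_data (ae_of_all _ h.nonneg_data),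
    h.integral_data, ENNReal.ofReal_one]

omit [Fintype ι] [DecidableEq ι] in
lemma law_absolutelyContinuous : law μ (p β) ≪ μ := withDensity_absolutelyContinuous _ _

lemma ae_pos (h : IsModel μ Θ p β) : ∀ᵐ x ∂law μ (p β), 0 < p β x := by
  rw [law, ae_withDensity_iff' h.integrable_data.aestronglyMeasurable.aemeasurable.ennreal_ofReal]
  filter_upwards with x hx
  simpa using hx

lemma integral_law (h : IsModel μ Θ p β) (f : X → ℝ) :
    ∫ x, f x ∂law μ (p β) = ∫ x, p β x * f x ∂μ := by
  rw [law, integral_withDensity_eq_integral_toReal_smul₀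
    h.integrable_data.aestronglyMeasurable.aemeasurable.ennreal_ofReal (by simp)]
  simp [ENNReal.toReal_ofReal (h.nonneg_data _)]

lemma ae_hasGradientAt_log (h : IsModel μ Θ p β) :
    ∀ᵐ x ∂law μ (p β), HasGradientAt (fun b => Real.log (p b x)) (score p β x) β := by
  filter_upwards [law_absolutelyContinuous.ae_le h.differentiable, h.ae_pos] with x hd hp
  exact (hd.log hp.ne').hasGradientAt

/-- The score is an a.e. limit of difference quotients of `log p`. A sequence of steps staying
inside `Θ` is needed, since measurability of `p b` is known only there. -/
lemma aemeasurable_score_apply (h : IsModel μ Θ p β) (i : ι) :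
    AEMeasurable (fun x => score p β x i) (law μ (p β)) := by
  obtain ⟨t, -, ht, htΘ⟩ :=
    exists_seq_tendsto_zero_add_smul_mem h.mem_nhds (EuclideanSpace.single i (1 : ℝ))
  have hlog : ∀ b ∈ Θ, AEMeasurable (fun x => Real.log (p b x)) (law μ (p β)) := fun b hb =>
    ((h.integrable b hb).aestronglyMeasurable.aemeasurable.log).mono_ac law_absolutelyContinuous
  refine aemeasurable_of_tendsto_metrizable_ae atTop
    (f := fun n x => (t n)⁻¹ * (Real.log (p (β + t n • EuclideanSpace.single i (1 : ℝ)) x) -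
      Real.log (p β x)))
    (fun n => ((hlog _ (htΘ n)).sub (hlog _ (mem_of_mem_nhds h.mem_nhds))).const_mul _) ?_
  filter_upwards [h.ae_hasGradientAt_log] with x hx
  exact (tendsto_slope_of_hasGradientAt hx i).comp ht

lemma memLp_score_apply (h : IsModel μ Θ p β) (i : ι) :
    MemLp (fun x => score p β x i) 2 (law μ (p β)) := by
  have hm := (h.aemeasurable_score_apply i).aestronglyMeasurable
  refine (memLp_two_iff_integrable_sq hm).2 (h.finite_info.mono' (hm.pow 2) ?_)
  filter_upwards with x
  rw [Real.norm_eq_abs, abs_of_nonneg (sq_nonneg _), ← sq_abs (score p β x i)]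
  have := PiLp.norm_apply_le (score p β x) i
  rw [Real.norm_eq_abs] at this
  gcongr

lemma integrable_score_apply (h : IsModel μ Θ p β) (i : ι) :
    Integrable (fun x => score p β x i) (law μ (p β)) := by
  have := h.isProbabilityMeasure_law
  exact (h.memLp_score_apply i).integrable (by norm_num)

lemma integrable_score_mul_score (h : IsModel μ Θ p β) (i j : ι) :
    Integrable (fun x => score p β x i * score p β x j) (law μ (p β)) :=
  (h.memLp_score_apply i).integrable_mul (h.memLp_score_apply j)

end IsModel

lemma weightOne_sq (x : X) :
    weightOne μ p β x ^ 2 =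
      ∑ i, ((fisherInfo μ p β)⁻¹ *ᵥ (score p β x).ofLp) i ^ 2 := by
  rw [weightOne, EuclideanSpace.real_norm_sq_eq]

lemma weightOne_nonneg (x : X) : 0 ≤ weightOne μ p β x := norm_nonneg _

omit [DecidableEq ι] in
lemma scoreCov_transpose (w : X → ℝ) : (scoreCov μ p β w)ᵀ = scoreCov μ p β w := by
  ext i j
  simp [scoreCov, mul_right_comm]

lemma fisherInfo_inv_transpose : (fisherInfo μ p β)⁻¹ᵀ = (fisherInfo μ p β)⁻¹ := by
  rw [Matrix.transpose_nonsing_inv, fisherInfo, scoreCov_transpose]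

/-- The quadratic form of `I⁻¹` against a reweighted second moment of the score. -/
lemma trace_inv_mul_scoreCov_mul_inv (w : X → ℝ)
    (hw : ∀ i j, Integrable (fun x => w x * (score p β x i * score p β x j)) (law μ (p β))) :
    ((fisherInfo μ p β)⁻¹ * scoreCov μ p β w * (fisherInfo μ p β)⁻¹).trace =
      ∫ x, w x * weightOne μ p β x ^ 2 ∂law μ (p β) := by
  set B := (fisherInfo μ p β)⁻¹ with hB
  have hsymm : ∀ i j, B i j = B j i := fun i j =>
    congrFun (congrFun fisherInfo_inv_transpose j) i
  have hx : ∀ x, w x * weightOne μ p β x ^ 2 = ∑ i, ∑ j, ∑ k,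
      B i j * B i k * (w x * (score p β x j * score p β x k)) := by
    intro x
    rw [weightOne_sq, Finset.mul_sum]
    refine Finset.sum_congr rfl fun i _ => ?_
    rw [← hB, Matrix.mulVec, dotProduct, sq, Finset.sum_mul_sum, Finset.mul_sum]
    refine Finset.sum_congr rfl fun j _ => ?_
    rw [Finset.mul_sum]
    exact Finset.sum_congr rfl fun k _ => by ring
  have hi := fun i j k => (hw j k).const_mul (B i j * B i k)
  simp only [hx]
  rw [integral_finsetSum _ fun i _ => integrable_finsetSum _ fun j _ =>
    integrable_finsetSum _ fun k _ => hi i j k]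
  simp only [Matrix.trace, Matrix.diag_apply, Matrix.mul_apply]
  refine Finset.sum_congr rfl fun i _ => ?_
  rw [integral_finsetSum _ fun j _ => integrable_finsetSum _ fun k _ => hi i j k]
  simp only [Finset.sum_mul]
  rw [Finset.sum_comm]
  refine Finset.sum_congr rfl fun j _ => ?_
  rw [integral_finsetSum _ fun k _ => hi i j k]
  refine Finset.sum_congr rfl fun k _ => ?_
  rw [integral_const_mul, hsymm k i, scoreCov, Matrix.of_apply]
  simp only [mul_assoc]
  ring

namespace IsModel

lemma aemeasurable_weightOne (h : IsModel μ Θ p β) :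
    AEMeasurable (weightOne μ p β) (law μ (p β)) := by
  have : weightOne μ p β = fun x =>
      √(∑ i, (∑ j, (fisherInfo μ p β)⁻¹ i j * score p β x j) ^ 2) := by
    ext x
    rw [weightOne, EuclideanSpace.norm_eq]
    simp [Matrix.mulVec, dotProduct]
  rw [this]
  exact (Finset.aemeasurable_fun_sum _ fun i _ => (Finset.aemeasurable_fun_sum _ fun j _ =>
    (h.aemeasurable_score_apply j).const_mul _).pow_const 2).sqrt

lemma memLp_weightOne (h : IsModel μ Θ p β) : MemLp (weightOne μ p β) 2 (law μ (p β)) := by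
  rw [memLp_two_iff_integrable_sq h.aemeasurable_weightOne.aestronglyMeasurable]
  simp only [weightOne_sq, Matrix.mulVec, dotProduct]
  refine integrable_finsetSum _ fun i _ => ?_
  exact (memLp_finsetSum _ fun j _ => (h.memLp_score_apply j).const_mul _).integrable_sq

lemma integrable_weightOne (h : IsModel μ Θ p β) :
    Integrable (weightOne μ p β) (law μ (p β)) := by
  have := h.isProbabilityMeasure_law
  exact h.memLp_weightOne.integrable (by norm_num)

/-- Writing `ψ = I (I⁻¹ ψ)` bounds each coordinate by the entries of `I` times `w₁`. In particular
`ψ` vanishes wherever `w₁` does. -/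
lemma exists_abs_score_le (h : IsModel μ Θ p β) :
    ∃ C, 0 ≤ C ∧ ∀ x i, |score p β x i| ≤ weightOne μ p β x * C := by
  refine ⟨∑ i, ∑ j, |fisherInfo μ p β i j|, by positivity, fun x i => ?_⟩
  have hs : (score p β x).ofLp =
      fisherInfo μ p β *ᵥ ((fisherInfo μ p β)⁻¹ *ᵥ (score p β x).ofLp) := by
    rw [Matrix.mulVec_mulVec, Matrix.mul_nonsing_inv _ h.invertible_info, Matrix.one_mulVec]
  rw [hs, Matrix.mulVec, dotProduct, Finset.mul_sum]
  refine (Finset.abs_sum_le_sum_abs _ _).trans ?_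
  refine le_trans ?_ (Finset.single_le_sum
    (f := fun i => weightOne μ p β x * ∑ j, |fisherInfo μ p β i j|)
    (fun k _ => mul_nonneg (weightOne_nonneg x) (by positivity)) (Finset.mem_univ i))
  rw [Finset.mul_sum]
  refine Finset.sum_le_sum fun j _ => ?_
  rw [abs_mul, mul_comm]
  gcongr
  exact PiLp.norm_apply_le
    (WithLp.toLp 2 ((fisherInfo μ p β)⁻¹ *ᵥ (score p β x).ofLp) : Param ι) j

/-- Otherwise `w₁`, hence `ψ`, vanishes almost everywhere and `I = 0`, which is singular in positive
dimension. -/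
lemma integral_weightOne_pos [Nonempty ι] (h : IsModel μ Θ p β) :
    0 < ∫ x, weightOne μ p β x ∂law μ (p β) := by
  refine (integral_nonneg weightOne_nonneg).lt_of_ne fun h0 => ?_
  have hz := (integral_eq_zero_iff_of_nonneg weightOne_nonneg h.integrable_weightOne).1 h0.symm
  obtain ⟨C, -, hC⟩ := h.exists_abs_score_le
  have hI : fisherInfo μ p β = 0 := by
    ext i j
    simp only [fisherInfo, scoreCov, Matrix.of_apply, Matrix.zero_apply]
    refine integral_eq_zero_of_ae ?_
    filter_upwards [hz] with x hx
    have := hC x i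
    rw [hx, Pi.zero_apply, zero_mul, abs_nonpos_iff] at this
    simp [this]
  simpa [hI, Matrix.det_zero] using h.invertible_info

lemma trace_fisherInfo_inv (h : IsModel μ Θ p β) :
    (fisherInfo μ p β)⁻¹.trace = ∫ x, weightOne μ p β x ^ 2 ∂law μ (p β) := by
  have := trace_inv_mul_scoreCov_mul_inv (μ := μ) (p := p) (β := β) (fun _ => 1)
    (fun i j => by simpa using h.integrable_score_mul_score i j)
  rw [← fisherInfo, Matrix.nonsing_inv_mul _ h.invertible_info, one_mul] at this
  simpa using this

end IsModel

/-- Since `p ψ = ∇p`, this is the derivative of the constant `∫ p = 1`, taken under the integral by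
dominated convergence. -/
lemma IsNormalizedModel.integral_score (h : IsNormalizedModel μ Θ p β) (i : ι) :
    ∫ x, score p β x i ∂law μ (p β) = 0 := by
  obtain ⟨g, hg, hpg⟩ := h.dominated
  let e : Param ι := EuclideanSpace.single i (1 : ℝ)
  have he : ‖e‖ = 1 := by simp [e]
  obtain ⟨t, ht0, ht, htΘ⟩ := exists_seq_tendsto_zero_add_smul_mem h.mem_nhds e
  have hβ := mem_of_mem_nhds h.mem_nhds
  rw [h.toIsModel.integral_law]
  have hlim : Tendsto (fun n => ∫ x, (t n)⁻¹ * (p (β + t n • e) x - p β x) ∂μ) atTop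
      (𝓝 (∫ x, p β x * score p β x i ∂μ)) := by
    refine tendsto_integral_of_dominated_convergence g (fun n => ?_) hg (fun n => ?_) ?_
    · exact ((h.integrable _ (htΘ n)).sub (h.integrable _ hβ)).aestronglyMeasurable.const_mul _
    · filter_upwards [hpg] with x hx
      have := hx _ (htΘ n)
      rw [add_sub_cancel_left, norm_smul, he, mul_one,
        Real.norm_eq_abs, abs_of_pos (ht0 n)] at this
      rw [norm_mul, norm_inv, Real.norm_eq_abs, Real.norm_eq_abs, abs_of_pos (ht0 n),
        inv_mul_le_iff₀ (ht0 n)]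
      linarith
    · filter_upwards [h.differentiable] with x hx
      suffices HasGradientAt (fun b => p b x) (p β x • score p β x) β by
        exact (tendsto_slope_of_hasGradientAt this i).comp ht
      -- Where `p β x = 0` the logarithm gives nothing, but nonnegativity makes `β` a local minimum
      -- of `b ↦ p b x`, so its gradient is zero there.
      rcases (h.toIsModel.nonneg_data x).eq_or_lt with h0 | h0
      · have hmin : IsLocalMin (fun b => p b x) β := by
          filter_upwards [h.mem_nhds] with b hb
          rw [← h0]
          exact h.nonneg b hb x
        rw [← h0, zero_smul]
        have := hx.hasFDerivAt
        rw [hmin.hasFDerivAt_eq_zero this] at this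
        rw [hasGradientAt_iff_hasFDerivAt, map_zero]
        exact this
      · have hl := (hx.log h0.ne').hasGradientAt
        have hs := hx.hasFDerivAt.log h0.ne'
        rw [hasGradientAt_iff_hasFDerivAt] at hl
        have heq := hl.unique hs
        rw [hasGradientAt_iff_hasFDerivAt, map_smul, score, heq, smul_inv_smul₀ h0.ne']
        exact hx.hasFDerivAt
  have hzero : ∀ n, ∫ x, (t n)⁻¹ * (p (β + t n • e) x - p β x) ∂μ = 0 := by
    intro n
    rw [integral_const_mul, integral_sub (h.integrable _ (htΘ n)) (h.integrable _ hβ),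
      h.normalized _ (htΘ n), h.normalized _ hβ, sub_self, mul_zero]
  simp only [hzero] at hlim
  exact tendsto_nhds_unique hlim tendsto_const_nhds

end Model

/-- Where the data density is positive, `log p = log q - c`. -/
lemma score_unnormalized_inr {X κ : Type*} [MeasurableSpace X] [Fintype κ] [DecidableEq κ]
    {μ : Measure X} {Θ : Set (Param (κ ⊕ Unit))} {q : Param κ → X → ℝ} {β : Param (κ ⊕ Unit)}
    (h : IsModel μ Θ (unnormalized q) β) :
    ∀ᵐ x ∂law μ (unnormalized q β), score (unnormalized q) β x (Sum.inr ()) = -1 := by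
  filter_upwards [h.ae_hasGradientAt_log, h.ae_pos] with x hx hp
  refine tendsto_nhds_unique (tendsto_slope_of_hasGradientAt hx (Sum.inr ()))
    (tendsto_const_nhds.congr' ?_)
  filter_upwards [self_mem_nhdsWithin] with t (ht : 0 < t)
  have hq : q (WithLp.toLp 2 fun k => β (Sum.inl k)) x ≠ 0 := by
    intro h0
    simp [unnormalized, h0] at hp
  have hinl : (WithLp.toLp 2 fun k => (β + t • EuclideanSpace.single (Sum.inr ()) (1 : ℝ) :
      Param (κ ⊕ Unit)) (Sum.inl k) : Param κ) = WithLp.toLp 2 fun k => β (Sum.inl k) := by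
    ext k
    simp
  simp only [unnormalized]
  rw [hinl, Real.log_div hq (Real.exp_pos _).ne', Real.log_div hq (Real.exp_pos _).ne',
    Real.log_exp, Real.log_exp]
  simp only [PiLp.add_apply, PiLp.smul_apply, PiLp.single_apply, if_true, smul_eq_mul, mul_one]
  field_simp
  ring

/-! ### Asymptotics of the weights `z / (z + ν a)` under the integral -/

lemma tendsto_add_one_mul_div_add_mul {z a : ℝ} (ha : a ≠ 0) :
    Tendsto (fun ν : ℝ => (ν + 1) * (z / (z + ν * a))) atTop (𝓝 (z / a)) := by
  have hinv := tendsto_inv_atTop_zero (𝕜 := ℝ)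
  have h : Tendsto (fun ν : ℝ => (1 + ν⁻¹) * (z / (z * ν⁻¹ + a))) atTop
      (𝓝 ((1 + 0) * (z / (z * 0 + a)))) :=
    (tendsto_const_nhds.add hinv).mul (tendsto_const_nhds.div
      ((tendsto_const_nhds.mul hinv).add tendsto_const_nhds) (by simpa using ha))
  simp only [add_zero, mul_zero, zero_add, one_mul] at h
  refine h.congr' ?_
  filter_upwards [eventually_gt_atTop 0] with ν hν
  have : z + ν * a = ν * (z * ν⁻¹ + a) := by field_simp
  rw [this, ← div_div]
  field_simp

lemma tendsto_integral_div_add_mul {X : Type*} [MeasurableSpace X] {P : Measure X}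
    {a f b : X → ℝ} {z : ℝ} (hz : 0 < z) (ha : AEMeasurable a P) (ha0 : ∀ x, 0 ≤ a x)
    (hf : AEMeasurable f P) (hb : Integrable b P) (hb0 : ∀ x, 0 ≤ b x)
    (hfb : ∀ x, |f x| ≤ a x * b x) :
    Tendsto (fun ν : ℝ => (ν + 1) * ∫ x, z / (z + ν * a x) * f x ∂P) atTop
      (𝓝 (∫ x, z / a x * f x ∂P)) := by
  simp_rw [← integral_const_mul]
  -- The factor `2` comes from `ν + 1 ≤ 2ν` for `ν ≥ 1`, which gives `(ν + 1) a ≤ 2 (z + ν a)`.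
  refine tendsto_integral_filter_of_dominated_convergence (fun x => 2 * z * b x) ?_ ?_
    (hb.const_mul _) (ae_of_all _ fun x => ?_)
  · filter_upwards with ν
    exact (((aemeasurable_const.div (aemeasurable_const.add (ha.const_mul ν))).mul hf).const_mul
      _).aestronglyMeasurable
  · filter_upwards [eventually_ge_atTop 1] with ν hν
    filter_upwards with x
    have hνa : 0 ≤ ν * a x := mul_nonneg (by linarith) (ha0 x)
    have hd : 0 < z + ν * a x := by linarith
    rw [Real.norm_eq_abs, abs_mul, abs_mul, abs_of_pos (div_pos hz hd),
      abs_of_pos (by linarith : 0 < ν + 1), ← mul_assoc, mul_div_assoc', div_mul_eq_mul_div,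
      div_le_iff₀ hd]
    have h1 : (ν + 1) * a x ≤ 2 * (z + ν * a x) := by nlinarith [ha0 x]
    calc (ν + 1) * z * |f x| ≤ (ν + 1) * z * (a x * b x) := by
          gcongr
          exact hfb x
      _ = (ν + 1) * a x * (z * b x) := by ring
      _ ≤ 2 * (z + ν * a x) * (z * b x) :=
          mul_le_mul_of_nonneg_right h1 (mul_nonneg hz.le (hb0 x))
      _ = 2 * z * b x * (z + ν * a x) := by ring
  -- Where `a` vanishes the bound forces `f` to vanish, so the convention `z / 0 = 0` gives the
  -- right limit.
  · by_cases hx : a x = 0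
    · have hfx : f x = 0 := by simpa [hx] using hfb x
      simp [hfx]
    · simp_rw [← mul_assoc]
      exact (tendsto_add_one_mul_div_add_mul hx).mul_const _

lemma div_mul_le_of_le_mul {z a y b : ℝ} (hz : 0 ≤ z) (ha : 0 ≤ a) (hb : 0 ≤ b)
    (hy : y ≤ a * b) : z / a * y ≤ z * b := by
  rcases ha.eq_or_lt with rfl | ha
  · simpa using mul_nonneg hz hb
  · calc z / a * y ≤ z / a * (a * b) := by gcongr
      _ = z * b := by field_simp

lemma div_mul_mul_self (z a : ℝ) : z / a * a * a = z * a := by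
  by_cases h : a = 0
  · simp [h]
  · rw [div_mul_cancel₀ _ h]

/-! ### Perturbation of the matrix inverse and the mean penalty -/

lemma tendsto_matrix_inv {α n : Type*} [Fintype n] [DecidableEq n] {l : Filter α}
    {S : α → Matrix n n ℝ} {A : Matrix n n ℝ} (hA : IsUnit A.det) (hS : Tendsto S l (𝓝 A)) :
    Tendsto (fun a => (S a)⁻¹) l (𝓝 A⁻¹) := by
  simp only [Matrix.inv_def, Ring.inverse_eq_inv']
  have hdet : Tendsto (fun a => (S a).det) l (𝓝 A.det) :=
    ((continuous_id.matrix_det).tendsto A).comp hS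
  exact (hdet.inv₀ hA.ne_zero).smul (((continuous_id.matrix_adjugate).tendsto A).comp hS)

lemma tendsto_of_tendsto_add_one_smul {E : Type*} [AddCommGroup E] [Module ℝ E]
    [TopologicalSpace E] [IsTopologicalAddGroup E] [ContinuousSMul ℝ E] {S : ℝ → E} {A D : E}
    (h : Tendsto (fun ν : ℝ => (ν + 1) • (A - S ν)) atTop (𝓝 D)) :
    Tendsto S atTop (𝓝 A) := by
  have h0 : Tendsto (fun ν : ℝ => (ν + 1)⁻¹) atTop (𝓝 0) :=
    tendsto_inv_atTop_zero.comp (tendsto_atTop_add_const_right _ _ tendsto_id)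
  have h1 := tendsto_const_nhds (x := A).sub (h0.smul h)
  rw [zero_smul, sub_zero] at h1
  refine h1.congr' ?_
  filter_upwards [eventually_gt_atTop 0] with ν hν
  rw [inv_smul_smul₀ (by positivity), sub_sub_cancel]

/-- First-order expansion of the matrix inverse along `S ν = A - D / (ν + 1) + o(1 / ν)`. -/
lemma tendsto_add_one_smul_inv_sub_inv {n : Type*} [Fintype n] [DecidableEq n]
    {S : ℝ → Matrix n n ℝ} {A D : Matrix n n ℝ} (hA : IsUnit A.det)
    (h : Tendsto (fun ν : ℝ => (ν + 1) • (A - S ν)) atTop (𝓝 D)) :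
    Tendsto (fun ν : ℝ => (ν + 1) • ((S ν)⁻¹ - A⁻¹)) atTop (𝓝 (A⁻¹ * D * A⁻¹)) := by
  have hS := tendsto_of_tendsto_add_one_smul h
  have hdet : Tendsto (fun a => (S a).det) atTop (𝓝 A.det) :=
    ((continuous_id.matrix_det).tendsto A).comp hS
  -- Resolvent identity: `S⁻¹ - A⁻¹ = S⁻¹ (A - S) A⁻¹`.
  refine (((tendsto_matrix_inv hA hS).mul h).mul_const A⁻¹).congr' ?_
  filter_upwards [hdet.eventually_ne hA.ne_zero] with ν hν
  rw [Matrix.mul_smul, Matrix.smul_mul, mul_sub, sub_mul,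
    Matrix.nonsing_inv_mul _ (isUnit_iff_ne_zero.2 hν), one_mul,
    Matrix.mul_assoc, Matrix.mul_nonsing_inv _ hA, mul_one]

/-- The penalty `tr (S⁻¹ m mᵀ S⁻¹)` of a nonzero score mean. -/
noncomputable def meanPenalty {n : Type*} [Fintype n] [DecidableEq n] (S : Matrix n n ℝ)
    (m : n → ℝ) : ℝ :=
  (S⁻¹ * Matrix.vecMulVec m m * S⁻¹).trace

/-- By symmetry the row is `S e_k`, so `S⁻¹ m = -e_k`, a unit vector, and the penalty is its squared
norm. -/
lemma meanPenalty_neg_row {n : Type*} [Fintype n] [DecidableEq n] {S : Matrix n n ℝ}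
    (hS : IsUnit S.det) (hsymm : Sᵀ = S) (k : n) : meanPenalty S (-S k) = 1 := by
  have hrow : S k = Pi.single k (1 : ℝ) ᵥ* S := by simp [Matrix.row]
  have hcol : S k = S *ᵥ Pi.single k (1 : ℝ) := by
    rw [hrow]
    conv_lhs => rw [← hsymm]
    rw [Matrix.vecMul_transpose]
  rw [meanPenalty, Matrix.mul_vecMulVec, Matrix.vecMulVec_mul, Matrix.trace_vecMulVec,
    Matrix.mulVec_neg, Matrix.neg_vecMul, neg_dotProduct_neg]
  nth_rw 1 [hcol]
  rw [hrow, Matrix.mulVec_mulVec, Matrix.vecMul_vecMul, Matrix.nonsing_inv_mul _ hS,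
    Matrix.mul_nonsing_inv _ hS]
  simp

lemma meanPenalty_smul {n : Type*} [Fintype n] [DecidableEq n] (S : Matrix n n ℝ) (c : ℝ)
    (m : n → ℝ) : meanPenalty S (c • m) = c ^ 2 * meanPenalty S m := by
  simp only [meanPenalty, Matrix.smul_vecMulVec, Matrix.vecMulVec_smul, Matrix.mul_smul,
    Matrix.smul_mul, Matrix.trace_smul, smul_eq_mul]
  ring

lemma tendsto_meanPenalty {α n : Type*} [Fintype n] [DecidableEq n] {l : Filter α}
    {S : α → Matrix n n ℝ} {A : Matrix n n ℝ} {m : α → n → ℝ} {v : n → ℝ} (hA : IsUnit A.det)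
    (hS : Tendsto S l (𝓝 A)) (hm : Tendsto m l (𝓝 v)) :
    Tendsto (fun a => meanPenalty (S a) (m a)) l (𝓝 (meanPenalty A v)) := by
  have hinv := tendsto_matrix_inv hA hS
  have hv : Tendsto (fun a => Matrix.vecMulVec (m a) (m a)) l (𝓝 (Matrix.vecMulVec v v)) :=
    ((continuous_id.matrix_vecMulVec continuous_id).tendsto v).comp hm
  exact ((continuous_id.matrix_trace).tendsto _).comp ((hinv.mul hv).mul hinv)

/-! ### Expansion of the mean-squared error for large `ν` -/

section Model

variable {X ι : Type*} [MeasurableSpace X] [Fintype ι] [DecidableEq ι] {μ : Measure X}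
  {Θ : Set (Param ι)} {p : Param ι → X → ℝ} {β : Param ι}

lemma mse_eq (T ν : ℝ) (pn : X → ℝ) :
    mse μ p β T ν pn = (ν + 1) / T *
      ((scoreCov μ p β (noisePosterior ν (p β) pn))⁻¹.trace - (ν + 1) / ν *
        meanPenalty (scoreCov μ p β (noisePosterior ν (p β) pn))
          (scoreMean μ p β (noisePosterior ν (p β) pn))) := by
  simp [mse, meanPenalty, Matrix.trace_sub, Matrix.trace_smul]

namespace IsModel

/-- The weight is the constant `c = ν / (ν + 1)`. The trace scales by `c⁻¹`, while the penalty is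
unchanged: `c²` from the mean cancels `c⁻²` from the two inverses. -/
lemma mse_data (h : IsModel μ Θ p β) (T : ℝ) {ν : ℝ} (hν : 0 < ν) :
    mse μ p β T ν (p β) = (ν + 1) ^ 2 / (ν * T) *
      ((fisherInfo μ p β)⁻¹.trace -
        meanPenalty (fisherInfo μ p β) (scoreMean μ p β fun _ => 1)) := by
  set c := ν / (ν + 1) with hc
  have hc0 : c ≠ 0 := by positivity
  have hw : ∀ᵐ x ∂law μ (p β), noisePosterior ν (p β) (p β) x = c := by
    filter_upwards [h.ae_pos] with x hx
    rw [noisePosterior, hc]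
    field_simp
    ring
  have hS : scoreCov μ p β (noisePosterior ν (p β) (p β)) = c • fisherInfo μ p β := by
    ext i j
    simp only [fisherInfo, scoreCov, Matrix.of_apply, Matrix.smul_apply, smul_eq_mul, one_mul]
    rw [← integral_const_mul]
    refine integral_congr_ae ?_
    filter_upwards [hw] with x hx
    rw [hx, mul_assoc]
  have hm : scoreMean μ p β (noisePosterior ν (p β) (p β)) =
      c • scoreMean μ p β fun _ => 1 := by
    ext i
    simp only [scoreMean, Pi.smul_apply, smul_eq_mul, one_mul]
    rw [← integral_const_mul]
    refine integral_congr_ae ?_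
    filter_upwards [hw] with x hx
    rw [hx]
  have hinv : (c • fisherInfo μ p β)⁻¹ = c⁻¹ • (fisherInfo μ p β)⁻¹ := by
    have := invertibleOfNonzero hc0
    rw [Matrix.inv_smul _ _ h.invertible_info, invOf_eq_inv]
  rw [mse_eq, hS, hm, meanPenalty_smul]
  simp only [meanPenalty, hinv, Matrix.trace_smul, Matrix.smul_mul, Matrix.mul_smul, smul_eq_mul]
  rw [hc]
  field_simp

lemma integral_optimalNoise (h : IsModel μ Θ p β) :
    ∫ y, p β y * weightOne μ p β y ∂μ = ∫ x, weightOne μ p β x ∂law μ (p β) :=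
  (h.integral_law _).symm

lemma ae_noisePosterior_optimalNoise [Nonempty ι] (h : IsModel μ Θ p β) {ν : ℝ} (hν : 0 ≤ ν) :
    ∀ᵐ x ∂law μ (p β), noisePosterior ν (p β) (optimalNoise μ p β) x =
      1 - (∫ x, weightOne μ p β x ∂law μ (p β)) /
        ((∫ x, weightOne μ p β x ∂law μ (p β)) + ν * weightOne μ p β x) := by
  have hz := h.integral_weightOne_pos
  filter_upwards [h.ae_pos] with x hx
  rw [noisePosterior, optimalNoise, normalizedProduct, h.integral_optimalNoise]
  have hw : 0 ≤ weightOne μ p β x := weightOne_nonneg x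
  generalize (∫ x, weightOne μ p β x ∂law μ (p β)) = z at *
  generalize weightOne μ p β x = a at *
  generalize p β x = y at *
  have hd : 0 < z + ν * a := by positivity
  have : y + ν * (y * a / z) = y * (z + ν * a) / z := by field_simp
  rw [this]
  field_simp
  ring

/-- The first-order behaviour of `P(Y = 0 | x)`-weighted expectations for the optimal noise. -/
lemma tendsto_integral_optimalNoise [Nonempty ι] (h : IsModel μ Θ p β) {f b : X → ℝ}
    (hf : Integrable f (law μ (p β))) (hb : Integrable b (law μ (p β))) (hb0 : ∀ x, 0 ≤ b x)
    (hfb : ∀ x, |f x| ≤ weightOne μ p β x * b x) :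
    Tendsto (fun ν : ℝ => (ν + 1) * (∫ x, f x ∂law μ (p β) -
        ∫ x, noisePosterior ν (p β) (optimalNoise μ p β) x * f x ∂law μ (p β))) atTop
      (𝓝 (∫ x, (∫ x, weightOne μ p β x ∂law μ (p β)) / weightOne μ p β x * f x
        ∂law μ (p β))) := by
  have hz := h.integral_weightOne_pos
  refine (tendsto_integral_div_add_mul hz h.aemeasurable_weightOne weightOne_nonneg
    hf.aemeasurable hb hb0 hfb).congr' ?_
  filter_upwards [eventually_ge_atTop 0] with ν hν
  congr 1
  have hae := h.ae_noisePosterior_optimalNoise hν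
  set z := ∫ x, weightOne μ p β x ∂law μ (p β)
  have hi : Integrable (fun x => z / (z + ν * weightOne μ p β x) * f x) (law μ (p β)) := by
    refine hf.bdd_mul (c := 1) (aemeasurable_const.div (aemeasurable_const.add
      (h.aemeasurable_weightOne.const_mul ν))).aestronglyMeasurable (ae_of_all _ fun x => ?_)
    have hw : 0 ≤ ν * weightOne μ p β x := mul_nonneg hν (weightOne_nonneg x)
    have hd : 0 < z + ν * weightOne μ p β x := by linarith
    rw [Real.norm_eq_abs, abs_of_pos (div_pos hz hd), div_le_one hd]
    linarith
  have : ∫ x, noisePosterior ν (p β) (optimalNoise μ p β) x * f x ∂law μ (p β) =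
      ∫ x, (f x - z / (z + ν * weightOne μ p β x) * f x) ∂law μ (p β) := by
    refine integral_congr_ae ?_
    filter_upwards [hae] with x hx
    rw [hx]
    ring
  rw [this, integral_sub hf hi, sub_sub_cancel]

lemma tendsto_scoreMean_optimalNoise [Nonempty ι] (h : IsModel μ Θ p β) :
    Tendsto (fun ν : ℝ => (ν + 1) • ((scoreMean μ p β fun _ => 1) -
        scoreMean μ p β (noisePosterior ν (p β) (optimalNoise μ p β)))) atTop
      (𝓝 (scoreMean μ p β fun x =>
        (∫ x, weightOne μ p β x ∂law μ (p β)) / weightOne μ p β x)) := by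
  have := h.isProbabilityMeasure_law
  obtain ⟨C, hC0, hC⟩ := h.exists_abs_score_le
  refine tendsto_pi_nhds.2 fun i => ?_
  simpa [scoreMean] using h.tendsto_integral_optimalNoise (h.integrable_score_apply i)
    (integrable_const C) (fun _ => hC0) fun x => hC x i

lemma exists_abs_score_mul_score_le (h : IsModel μ Θ p β) (j : ι) :
    ∃ b : X → ℝ, Integrable b (law μ (p β)) ∧ (∀ x, 0 ≤ b x) ∧
      ∀ x i, |score p β x i * score p β x j| ≤ weightOne μ p β x * b x := by
  obtain ⟨C, hC0, hC⟩ := h.exists_abs_score_le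
  refine ⟨fun x => C * |score p β x j|, (h.integrable_score_apply j).abs.const_mul C,
    fun x => by positivity, fun x i => ?_⟩
  rw [abs_mul, ← mul_assoc]
  gcongr
  exact hC x i

lemma tendsto_scoreCov_optimalNoise [Nonempty ι] (h : IsModel μ Θ p β) :
    Tendsto (fun ν : ℝ => (ν + 1) • (fisherInfo μ p β -
        scoreCov μ p β (noisePosterior ν (p β) (optimalNoise μ p β)))) atTop
      (𝓝 (scoreCov μ p β fun x =>
        (∫ x, weightOne μ p β x ∂law μ (p β)) / weightOne μ p β x)) := by
  refine tendsto_pi_nhds.2 fun i => tendsto_pi_nhds.2 fun j => ?_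
  obtain ⟨b, hb, hb0, hC⟩ := h.exists_abs_score_mul_score_le j
  simpa [fisherInfo, scoreCov, mul_assoc] using
    h.tendsto_integral_optimalNoise (h.integrable_score_mul_score i j) hb hb0 fun x => hC x i

lemma tendsto_trace_inv_optimalNoise [Nonempty ι] (h : IsModel μ Θ p β) :
    Tendsto (fun ν : ℝ => (ν + 1) *
        ((scoreCov μ p β (noisePosterior ν (p β) (optimalNoise μ p β)))⁻¹.trace -
          (fisherInfo μ p β)⁻¹.trace)) atTop
      (𝓝 ((∫ x, weightOne μ p β x ∂law μ (p β)) ^ 2)) := by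
  have h1 := ((continuous_id.matrix_trace).tendsto _).comp
    (tendsto_add_one_smul_inv_sub_inv h.invertible_info h.tendsto_scoreCov_optimalNoise)
  set z := ∫ x, weightOne μ p β x ∂law μ (p β) with hz
  have hz0 : 0 ≤ z := integral_nonneg weightOne_nonneg
  have hi : ∀ i j, Integrable
      (fun x => z / weightOne μ p β x * (score p β x i * score p β x j)) (law μ (p β)) := by
    intro i j
    obtain ⟨b, hb, hb0, hC⟩ := h.exists_abs_score_mul_score_le j
    refine (hb.const_mul z).mono' ((aemeasurable_const.div h.aemeasurable_weightOne).mul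
      ((h.aemeasurable_score_apply i).mul (h.aemeasurable_score_apply j))).aestronglyMeasurable
      (ae_of_all _ fun x => ?_)
    rw [norm_mul, Real.norm_eq_abs, Real.norm_eq_abs,
      abs_of_nonneg (div_nonneg hz0 (weightOne_nonneg x))]
    exact div_mul_le_of_le_mul hz0 (weightOne_nonneg x) (hb0 x) (hC x i)
  have h2 : ∀ x, z / weightOne μ p β x * weightOne μ p β x ^ 2 = z * weightOne μ p β x :=
    fun x => by rw [sq, ← mul_assoc, div_mul_mul_self]
  simp only [id] at h1
  rw [trace_inv_mul_scoreCov_mul_inv _ hi] at h1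
  simp only [h2] at h1
  rw [integral_const_mul, ← hz, ← sq] at h1
  simpa [Function.comp_def, Matrix.trace_smul, Matrix.trace_sub] using h1

/-- The hypothesis `hpen` isolates the comparison of penalties, the only point where normalized and
unnormalized models need different arguments. -/
lemma tendsto_mse_data_sub_mse_optimalNoise [Nonempty ι] (h : IsModel μ Θ p β) (T : ℝ)
    (hpen : Tendsto (fun ν : ℝ => (ν + 1) ^ 2 / ν *
      (meanPenalty (scoreCov μ p β (noisePosterior ν (p β) (optimalNoise μ p β)))
          (scoreMean μ p β (noisePosterior ν (p β) (optimalNoise μ p β))) -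
        meanPenalty (fisherInfo μ p β) (scoreMean μ p β fun _ => 1))) atTop (𝓝 0)) :
    Tendsto (fun ν : ℝ => mse μ p β T ν (p β) - mse μ p β T ν (optimalNoise μ p β)) atTop
      (𝓝 (1 / T * variance (weightOne μ p β) (law μ (p β)))) := by
  have := h.isProbabilityMeasure_law
  have hratio : Tendsto (fun ν : ℝ => 1 + ν⁻¹) atTop (𝓝 1) := by
    simpa using tendsto_const_nhds (x := (1 : ℝ)).add (tendsto_inv_atTop_zero (𝕜 := ℝ))
  have hlim := (((hratio.mul_const (fisherInfo μ p β)⁻¹.trace).sub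
    h.tendsto_trace_inv_optimalNoise).add hpen).const_mul (1 / T)
  rw [one_mul, add_zero, h.trace_fisherInfo_inv] at hlim
  rw [variance_eq_sub h.memLp_weightOne]
  refine hlim.congr' ?_
  filter_upwards [eventually_gt_atTop 0] with ν hν
  rw [h.mse_data T hν, mse_eq, h.trace_fisherInfo_inv]
  field_simp
  ring

end IsModel

namespace IsNormalizedModel

lemma scoreMean_one (h : IsNormalizedModel μ Θ p β) : scoreMean μ p β (fun _ => 1) = 0 := by
  ext i
  simpa [scoreMean] using h.integral_score i

/-- The limit of `(ν + 1) m_w` is finite because `E[ψ] = 0`. The penalty is quadratic in the mean,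
so it absorbs `(ν + 1)²` and leaves a factor `1 / ν`. -/
lemma tendsto_meanPenalty_optimalNoise [Nonempty ι] (h : IsNormalizedModel μ Θ p β) :
    Tendsto (fun ν : ℝ => (ν + 1) ^ 2 / ν *
      meanPenalty (scoreCov μ p β (noisePosterior ν (p β) (optimalNoise μ p β)))
        (scoreMean μ p β (noisePosterior ν (p β) (optimalNoise μ p β)))) atTop (𝓝 0) := by
  have hm := h.toIsModel.tendsto_scoreMean_optimalNoise
  have hS := tendsto_of_tendsto_add_one_smul h.toIsModel.tendsto_scoreCov_optimalNoise
  have hp := (tendsto_inv_atTop_zero (𝕜 := ℝ)).mul (tendsto_meanPenalty h.invertible_info hS hm)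
  rw [zero_mul] at hp
  refine hp.congr fun ν => ?_
  rw [h.scoreMean_one, zero_sub, smul_neg, ← neg_smul, meanPenalty_smul]
  ring

lemma tendsto_mse_optimalNoise_sub_mseCramerRao [Nonempty ι] (h : IsNormalizedModel μ Θ p β)
    (T : ℝ) :
    Tendsto (fun ν : ℝ => mse μ p β T ν (optimalNoise μ p β) - mseCramerRao μ p β T ν) atTop
      (𝓝 (1 / T * (∫ x, weightOne μ p β x ∂law μ (p β)) ^ 2)) := by
  have hlim := (h.toIsModel.tendsto_trace_inv_optimalNoise.sub
    h.tendsto_meanPenalty_optimalNoise).const_mul (1 / T)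
  rw [sub_zero] at hlim
  refine hlim.congr fun ν => ?_
  rw [mse_eq, mseCramerRao, one_div_div]
  ring

end IsNormalizedModel

/-- In dimension zero `E[w₁] > 0` fails, but every trace and norm is zero. -/
lemma tendsto_mse_of_isEmpty [IsEmpty ι] (T : ℝ) :
    Tendsto (fun ν : ℝ => mse μ p β T ν (p β) - mse μ p β T ν (optimalNoise μ p β)) atTop
      (𝓝 (1 / T * variance (weightOne μ p β) (law μ (p β)))) ∧
    Tendsto (fun ν : ℝ => mse μ p β T ν (optimalNoise μ p β) - mseCramerRao μ p β T ν) atTop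
      (𝓝 (1 / T * (∫ x, weightOne μ p β x ∂law μ (p β)) ^ 2)) := by
  have hw : weightOne μ p β = 0 := by
    ext x
    rw [weightOne, Subsingleton.elim (WithLp.toLp 2 _ : Param ι) 0, norm_zero, Pi.zero_apply]
  simp [mse, mseCramerRao, hw]

end Model

/-- A score coordinate equal to `-1` makes `m_w` minus the corresponding row of `I_w`, whatever the
weight. -/
lemma IsModel.meanPenalty_unnormalized {X κ : Type*} [MeasurableSpace X] [Fintype κ]
    [DecidableEq κ] {μ : Measure X} {Θ : Set (Param (κ ⊕ Unit))} {q : Param κ → X → ℝ}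
    {β : Param (κ ⊕ Unit)} (h : IsModel μ Θ (unnormalized q) β) {w : X → ℝ}
    (hw : IsUnit (scoreCov μ (unnormalized q) β w).det) :
    meanPenalty (scoreCov μ (unnormalized q) β w) (scoreMean μ (unnormalized q) β w) = 1 := by
  have : scoreMean μ (unnormalized q) β w = -scoreCov μ (unnormalized q) β w (Sum.inr ()) := by
    ext i
    rw [Pi.neg_apply, scoreMean, scoreCov, Matrix.of_apply, ← integral_neg]
    refine integral_congr_ae ?_
    filter_upwards [score_unnormalized_inr h] with x hx
    rw [hx]
    ring
  rw [this, meanPenalty_neg_row hw (scoreCov_transpose w)]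

end NCE

theorem theorem2 {X : Type*} [MeasurableSpace X] (μ : Measure X) (d : ℕ) (T : ℝ) (hT : 0 < T) :
    -- normalized models, with parameter `β = θ`
    (∀ (Θ : Set (NCE.Param (Fin d))) (p : NCE.Param (Fin d) → X → ℝ) (β : NCE.Param (Fin d)),
      NCE.IsNormalizedModel μ Θ p β →
        Tendsto
          (fun ν : ℝ => NCE.mse μ p β T ν (p β) - NCE.mse μ p β T ν (NCE.optimalNoise μ p β))
          atTop (𝓝 (1 / T * variance (NCE.weightOne μ p β) (NCE.law μ (p β)))) ∧
        Tendsto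
          (fun ν : ℝ => NCE.mse μ p β T ν (NCE.optimalNoise μ p β) - NCE.mseCramerRao μ p β T ν)
          atTop (𝓝 (1 / T * (∫ x, NCE.weightOne μ p β x ∂(NCE.law μ (p β))) ^ 2))) ∧
    -- unnormalized models, with parameter `β = (θ, c)`
    (∀ (Θ : Set (NCE.Param (Fin d ⊕ Unit))) (q : NCE.Param (Fin d) → X → ℝ)
      (β : NCE.Param (Fin d ⊕ Unit)),
      NCE.IsModel μ Θ (NCE.unnormalized q) β →
        Tendsto
          (fun ν : ℝ => NCE.mse μ (NCE.unnormalized q) β T ν (NCE.unnormalized q β) -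
            NCE.mse μ (NCE.unnormalized q) β T ν (NCE.optimalNoise μ (NCE.unnormalized q) β))
          atTop (𝓝 (1 / T * variance (NCE.weightOne μ (NCE.unnormalized q) β)
            (NCE.law μ (NCE.unnormalized q β))))) := by
  refine ⟨fun Θ p β h => ?_, fun Θ q β h => ?_⟩
  · cases isEmpty_or_nonempty (Fin d)
    · exact NCE.tendsto_mse_of_isEmpty T
    · refine ⟨h.toIsModel.tendsto_mse_data_sub_mse_optimalNoise T ?_,
        h.tendsto_mse_optimalNoise_sub_mseCramerRao T⟩
      have h0 : NCE.meanPenalty (NCE.fisherInfo μ p β) 0 = 0 := by simp [NCE.meanPenalty]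
      simpa [h.scoreMean_one, h0] using h.tendsto_meanPenalty_optimalNoise
  · refine h.tendsto_mse_data_sub_mse_optimalNoise T (tendsto_const_nhds.congr' ?_)
    -- Since `I_w → I`, the matrix `I_w` is eventually invertible; from then on both penalties equal
    -- `1`.
    have hdet := ((continuous_id.matrix_det).tendsto _).comp
      (NCE.tendsto_of_tendsto_add_one_smul h.tendsto_scoreCov_optimalNoise)
    filter_upwards [hdet.eventually_ne h.invertible_info.ne_zero] with ν hν
    rw [h.meanPenalty_unnormalized (isUnit_iff_ne_zero.2 hν), NCE.fisherInfo,
      h.meanPenalty_unnormalized h.invertible_info, sub_self, mul_zero]
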